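/- **Setting.** An environment $\mathcal V$ consists of $N$ groups of $K$ arms each; pulling arm $(i,j)\in[N]\times[K]$ yields an independent reward vector in $\mathbb R^D$ with mean $\mu_{i,j}=(\mu_{i,j}^1,\dots,\mu_{i,j}^D)$. The efficiency vector of group $i$ is $R_i$, $R_i^d=\max_{j}\mu_{i,j}^d$, and for $\epsilon\ge 0$ the $\epsilon$-Pareto set is $\mathcal G^*_\epsilon=\{i:\ \nexists j\ \forall d:\ R_i^d+\epsilon<R_j^d\}$, $\mathcal G^*=\mathcal G^*_0$. Put $m(v,u)=[\min_d(u^d-v^d)]^+$ and $M(v,u)=[\max_d(v^d-u^d)]^+$. Let $\Delta_{i,j}=m(\mu_{i,j},R_i)$; for $i\notin\mathcal G^*$ let $\Delta_i=\max_{j\in\mathcal G^*}m(R_i,R_j)$; for $i\in\mathcal G^*$ let $\Delta_i=\min(\Delta_i^+,\Delta_i^-)$ with $\Delta_i^+=\min_{j\in\mathcal G^*\setminus\{i\}}\min(M(R_i,R_j),M(R_j,R_i))$ and $\Delta_i^-=\min_{j\notin\mathcal G^*}(M(R_j,R_i)+2\Delta_j)$ (a minimum over the empty set is $\infty$). Finally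 $\tilde\Delta_{i,j}=\max(\Delta_{i,j},\Delta_i,\epsilon)$. An algorithm consists of a (possibly randomized) sampling rule that chooses the next arm from the history, a stopping time $\tau$ of the history (the number of samples), and a recommended set of groups $\hat\imath_\tau\subseteq[N]$ that is a function of the history at time $\tau$. Let $b\ge 1$ ($b=1$ is the usual normalization). The algorithm is $(\epsilon,\delta)$-PAC if in every environment in which every reward component is $1$-sub-Gaussian around its mean and all means lie in $[0,b]$, $$\mathbb P\bigl(\tau<\infty,\ \text{not }(\mathcal G^*_0\subseteq\hat\imath_\tau\subseteq\mathcal G^*_\epsilon)\bigr)\le\delta .$$ **The class.** Let $a_1,\dots,a_5\in(0,1)$ satisfy $a_1>a_2$, $a_3-a_5>a_2-a_4$, $a_1-a_2<2(a_2-a_4)$, $a_2>2a_4$, $a_1<2a_2$, $\max(a_1,a_3)+2(a_1-a_2)<b$ and $a_2+\max(a_4,a_5)\le b$ (the last two conditions are automatic if $b\ge 2$). For $N,D>1$ and $K\ge 1$ let $\mathcal C_{a}$ be the class of environments such that: * every arm is fully dependent with $1$-Gaussian rewards: $X^d\sim\mathcal N(\mu_{i,j}^d,1)$ for every $d$, and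 almost surely $X^d=X^1+(\mu_{i,j}^d-\mu_{i,j}^1)$ for every $d$; * all $\mu_{i,j}^d$ lie in $(0,1)$, and $R_1=(a_1,a_2,a_3,\dots,a_3)$, $R_2=(a_2,a_1,a_3,\dots,a_3)$, $R_i=(a_4,a_4,a_5,\dots,a_5)$ for $i>2$; * for $i\in\{1,2\}$ and all $j$: $\mu_{i,j}^1,\mu_{i,j}^2>2a_2-a_1$, and $\mu_{i,j}^d\ge a_3-(a_1-a_2)$ for every $d\ge 3$. **Theorem (GPSI lower bound).** There is a universal constant $c>0$ such that for all $N,D>1$, $K\ge 1$ and $b\ge 1$ the following holds. 1. (Non-triviality.) Admissible numbers $a=(a_1,\dots,a_5)$ exist; for all of them $\mathcal C_a$ contains an environment of the kind considered in the PAC requirement, and $\bigcup_a\mathcal C_a$ is infinite. 2. For all admissible $a$, every $\mathcal V\in\mathcal C_a$, all small $\epsilon>0$, namely $0<\epsilon<\min\{a_1-a_2,\ a_2-a_4,\ b-\max(a_1,a_3)-2(a_1-a_2)\}$ (a positive bound), every $\delta\in(0,1)$ and every $(\epsilon,\delta)$-PAC algorithm whose stopping time is almost surely finite on $\mathcal V$,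 $$\mathbb E_{\mathcal V}[\tau]\ \ge\ c\sum_{i\in[N]}\sum_{j\in[K]}\frac{1}{\tilde\Delta_{i,j}^2}\,\log\frac{1}{2.4\,\delta}.$$ -/

import Mathlib

open MeasureTheory ProbabilityTheory
open scoped ENNReal NNReal

noncomputable section

namespace GroupBandit

/-! ### Environments, efficiency vectors and Pareto sets -/

/-- An environment with `N` groups of `K` arms each and `D`-dimensional rewards: every arm `(i, j)`
carries a reward distribution on `ℝ^D`. -/
abbrev Env (N K D : ℕ) := Fin N → Fin K → ProbabilityMeasure (Fin D → ℝ)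

variable {N K D : ℕ}

/-- The arm means tensor: component `d` of the mean reward vector of arm `(i, j)`. -/
def armMean (ν : Env N K D) (i : Fin N) (j : Fin K) (d : Fin D) : ℝ :=
  ∫ x, x d ∂(ν i j : Measure (Fin D → ℝ))

/-- The efficiency vector of group `i`: the componentwise maximum of the means of its arms. -/
def efficiency (ν : Env N K D) (i : Fin N) (d : Fin D) : ℝ :=
  ⨆ j : Fin K, armMean ν i j d

/-- The environments under consideration: every reward component of every arm is sub-Gaussian with
parameter `1` around its mean, and all means lie in `[0, b]`. -/
def IsAdmissible (b : ℝ) (ν : Env N K D) : Prop :=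
  ∀ i j d,
    HasSubgaussianMGF (fun x : Fin D → ℝ => x d - armMean ν i j d) 1
        (ν i j : Measure (Fin D → ℝ)) ∧
      armMean ν i j d ∈ Set.Icc 0 b

/-- `u` is strictly dominated by `v`. -/
def StrictlyDominated (u v : Fin D → ℝ) : Prop := ∀ d, u d < v d

/-- The `ε`-Pareto set of a family of efficiency vectors. For `ε = 0` this is the set of Pareto
optimal groups. -/
def paretoSet (ε : ℝ) (R : Fin N → Fin D → ℝ) : Set (Fin N) :=
  {i | ¬ ∃ j, StrictlyDominated (fun d => R i d + ε) (R j)}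

/-! ### Gaps -/

/-- `m(v, u) = [min_d (u^d - v^d)]^+`. -/
def mGap (v u : Fin D → ℝ) : ℝ := max (⨅ d, (u d - v d)) 0

/-- `M(v, u) = [max_d (v^d - u^d)]^+`. -/
def MGap (v u : Fin D → ℝ) : ℝ := max (⨆ d, (v d - u d)) 0

/-- The gap `max_{j ∈ G*} m(R_i, R_j)` of a non-optimal group `i`. Gaps take values in `[0, ∞]`, so
that a minimum over an empty set of groups is `∞`. -/
def subOptGap (R : Fin N → Fin D → ℝ) (i : Fin N) : ℝ≥0∞ :=
  ⨆ j ∈ paretoSet 0 R, ENNReal.ofReal (mGap (R i) (R j))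

/-- `Δ_i^+ = min_{j ∈ G* \ {i}} min(M(R_i, R_j), M(R_j, R_i))`. -/
def optGapPlus (R : Fin N → Fin D → ℝ) (i : Fin N) : ℝ≥0∞ :=
  ⨅ j ∈ paretoSet 0 R \ {i},
    min (ENNReal.ofReal (MGap (R i) (R j))) (ENNReal.ofReal (MGap (R j) (R i)))

/-- `Δ_i^- = min_{j ∉ G*} (M(R_j, R_i) + 2 Δ_j)`. -/
def optGapMinus (R : Fin N → Fin D → ℝ) (i : Fin N) : ℝ≥0∞ :=
  ⨅ j ∈ (paretoSet 0 R)ᶜ, (ENNReal.ofReal (MGap (R j) (R i)) + 2 * subOptGap R j)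

open Classical in
/-- The gap `Δ_i` of group `i`. -/
def groupGap (R : Fin N → Fin D → ℝ) (i : Fin N) : ℝ≥0∞ :=
  if i ∈ paretoSet 0 R then min (optGapPlus R i) (optGapMinus R i) else subOptGap R i

/-- The in-group gap `Δ_{i,j} = m(μ_{i,j}, R_i)` of arm `(i, j)`. -/
def armGap (ν : Env N K D) (i : Fin N) (j : Fin K) : ℝ :=
  mGap (armMean ν i j) (efficiency ν i)

/-- `max(Δ_{i,j}, Δ_i, ε)`. The group gap is finite as soon as there are two groups. -/
def totalGap (ε : ℝ) (ν : Env N K D) (i : Fin N) (j : Fin K) : ℝ :=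
  max (armGap ν i j) (max (groupGap (efficiency ν) i).toReal ε)

/-! ### Algorithms and their interaction with an environment -/

/-- What happens in one round: the arm that is pulled and the reward vector that is observed. -/
abbrev Obs (N K D : ℕ) := (Fin N × Fin K) × (Fin D → ℝ)

/-- The history of the first `t` rounds. -/
abbrev Hist (N K D t : ℕ) := Fin t → Obs N K D

/-- A sequential learning algorithm: a (possibly randomized) sampling rule that chooses the next
arm from the history, a stopping rule that decides from the history of the first `t` rounds whether
to stop after `t` samples, and a recommendation, based on the history, of a set of groups. -/
structure Algorithm (N K D : ℕ) where
  sample : (t : ℕ) → Kernel (Hist N K D t) (Fin N × Fin K)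
  isMarkov_sample : ∀ t, IsMarkovKernel (sample t)
  stopSet : (t : ℕ) → Set (Hist N K D t)
  measurableSet_stopSet : ∀ t, MeasurableSet (stopSet t)
  recommend : (t : ℕ) → Hist N K D t → Set (Fin N)
  measurableSet_recommend : ∀ t i, MeasurableSet {h | i ∈ recommend t h}

/-- The rewards of the environment, as a Markov kernel from arms to reward vectors. -/
def rewardKernel (ν : Env N K D) : Kernel (Fin N × Fin K) (Fin D → ℝ) :=
  Kernel.ofFunOfCountable fun a => (ν a.1 a.2 : Measure (Fin D → ℝ))

instance (ν : Env N K D) : IsMarkovKernel (rewardKernel ν) :=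
  ⟨fun a => inferInstanceAs (IsProbabilityMeasure (ν a.1 a.2 : Measure (Fin D → ℝ)))⟩

namespace Algorithm

instance (A : Algorithm N K D) (t : ℕ) : IsMarkovKernel (A.sample t) := A.isMarkov_sample t

/-- One round of the interaction: given the history of `t` rounds, draw the next arm from the
sampling rule, then draw a reward from that arm. -/
def step (A : Algorithm N K D) (ν : Env N K D) (t : ℕ) :
    Kernel (Hist N K D t) (Obs N K D) :=
  A.sample t ⊗ₖ Kernel.prodMkLeft (Hist N K D t) (rewardKernel ν)

instance (A : Algorithm N K D) (ν : Env N K D) (t : ℕ) : IsMarkovKernel (A.step ν t) := by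
  unfold step; infer_instance

/-- Rounds `0, …, n` read as a history of `n + 1` rounds. -/
def toHist (n : ℕ) (h : (s : Finset.Iic n) → Obs N K D) : Hist N K D (n + 1) :=
  fun s => h ⟨s, Finset.mem_Iic.2 (Nat.lt_succ_iff.1 s.2)⟩

theorem measurable_toHist (n : ℕ) : Measurable (toHist (N := N) (K := K) (D := D) n) :=
  measurable_pi_lambda _ fun _ => measurable_pi_apply _

/-- The law of the infinite sequence of rounds when the sampling rule of `A` interacts with `ν`. -/
def law (A : Algorithm N K D) (ν : Env N K D) : Measure (ℕ → Obs N K D) :=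
  Kernel.trajMeasure (X := fun _ => Obs N K D) (A.step ν 0 Fin.elim0)
    fun n => (A.step ν (n + 1)).comap (toHist n) (measurable_toHist n)

/-- The history of the first `t` rounds of a trajectory. -/
def hist (t : ℕ) (ω : ℕ → Obs N K D) : Hist N K D t := fun s => ω s

/-- The stopping time `τ`: the number of samples after which the algorithm stops. -/
def stopTime (A : Algorithm N K D) (ω : ℕ → Obs N K D) : ℕ∞ :=
  ⨅ (t : ℕ) (_ : hist t ω ∈ A.stopSet t), (t : ℕ∞)

/-- The recommended set of groups at the stopping time (relevant only if `τ` is finite). -/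
def output (A : Algorithm N K D) (ω : ℕ → Obs N K D) : Set (Fin N) :=
  A.recommend (A.stopTime ω).toNat (hist (A.stopTime ω).toNat ω)

/-- `(ε, δ)`-PAC for group Pareto set identification: in every environment with `1`-sub-Gaussian
rewards and means in `[0, b]`, the probability of stopping with a recommendation that misses a
Pareto optimal group or contains a group that is not `ε`-Pareto is at most `δ`. -/
def IsPAC (A : Algorithm N K D) (b ε δ : ℝ) : Prop :=
  ∀ ν : Env N K D, IsAdmissible b ν →
    A.law ν {ω | A.stopTime ω < ⊤ ∧
      ¬ (paretoSet 0 (efficiency ν) ⊆ A.output ω ∧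
          A.output ω ⊆ paretoSet ε (efficiency ν))} ≤ ENNReal.ofReal δ

/-- The expected number of samples. -/
def expectedSamples (A : Algorithm N K D) (ν : Env N K D) : ℝ≥0∞ :=
  ∫⁻ ω, (A.stopTime ω : ℝ≥0∞) ∂(A.law ν)

end Algorithm

/-! ### The class of instances -/

/-- The numbers that the efficiency vectors are made of. -/
structure Params where
  a₁ : ℝ
  a₂ : ℝ
  a₃ : ℝ
  a₄ : ℝ
  a₅ : ℝ

/-- The conditions on the numbers. The last two say that the means of the class are far enough
below the largest allowed mean `b`; they hold automatically if `b ≥ 2`. -/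
structure Params.IsValid (b : ℝ) (p : Params) : Prop where
  mem₁ : p.a₁ ∈ Set.Ioo 0 1
  mem₂ : p.a₂ ∈ Set.Ioo 0 1
  mem₃ : p.a₃ ∈ Set.Ioo 0 1
  mem₄ : p.a₄ ∈ Set.Ioo 0 1
  mem₅ : p.a₅ ∈ Set.Ioo 0 1
  lt₁₂ : p.a₂ < p.a₁
  lt₃₅ : p.a₂ - p.a₄ < p.a₃ - p.a₅
  gap_lt : p.a₁ - p.a₂ < 2 * (p.a₂ - p.a₄)
  lt₂₄ : 2 * p.a₄ < p.a₂
  lt₁_two : p.a₁ < 2 * p.a₂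
  room_opt : max p.a₁ p.a₃ + 2 * (p.a₁ - p.a₂) < b
  room_sub : p.a₂ + max p.a₄ p.a₅ ≤ b

/-- The efficiency vectors: `(a₁, a₂, a₃, …, a₃)` for the first group, `(a₂, a₁, a₃, …, a₃)` for the
second one and `(a₄, a₄, a₅, …, a₅)` for all others. -/
def Params.eff (p : Params) (i : Fin N) (d : Fin D) : ℝ :=
  if i.val < 2 then
    if d.val < 2 then (if d.val = i.val then p.a₁ else p.a₂) else p.a₃
  else
    if d.val < 2 then p.a₄ else p.a₅

/-- The bound below which `ε` is small for these numbers. -/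
def Params.smallEps (b : ℝ) (p : Params) : ℝ :=
  min (min (p.a₁ - p.a₂) (p.a₂ - p.a₄)) (b - (max p.a₁ p.a₃ + 2 * (p.a₁ - p.a₂)))

/-- All arms of the environment are fully dependent with `1`-Gaussian rewards: every reward
component is a Gaussian of variance `1`, and any two components of the reward vector of an arm
differ by the constant that is the difference of their means. -/
structure IsFullyDependentGaussian (ν : Env N K D) : Prop where
  gaussian : ∀ i j d, (ν i j : Measure (Fin D → ℝ)).map (fun x => x d)
    = gaussianReal (armMean ν i j d) 1
  dependent : ∀ i j d d', ∀ᵐ x ∂(ν i j : Measure (Fin D → ℝ)),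
    x d = x d' + (armMean ν i j d - armMean ν i j d')

/-- The instances of the class with the numbers `p`. The arms of the first two groups must not be
too bad; there is no such condition on the arms of the other groups. -/
structure IsHardInstance (p : Params) (ν : Env N K D) : Prop where
  dist : IsFullyDependentGaussian ν
  mean_mem : ∀ i j d, armMean ν i j d ∈ Set.Ioo 0 1
  efficiency_eq : ∀ i d, efficiency ν i d = p.eff i d
  lower_first : ∀ (i : Fin N) (j : Fin K) (d : Fin D), i.val < 2 → d.val < 2 →
    2 * p.a₂ - p.a₁ < armMean ν i j d
  lower_rest : ∀ (i : Fin N) (j : Fin K) (d : Fin D), i.val < 2 → 2 ≤ d.val →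
    p.a₃ - (p.a₁ - p.a₂) ≤ armMean ν i j d

end GroupBandit

end

noncomputable section

namespace GroupBandit

variable {N K D : ℕ}

namespace Algorithm

/-! ### The law of the history -/

/-! The proof is a change of measure, one arm at a time. Translating all components of one arm by
`s` gives another environment. Full dependence makes the likelihood ratio of a pull that of two unit
Gaussians at distance `s`, whatever `D` is. If a property of the output has probability at least `1
- δ` before the translation and at most `δ` after it, the arm must be pulled of order `log (1 / δ) /
s ^ 2` times in expectation (`Algorithm.le_lintegral_stoppedCount`).

A translation comparable to the gap changes the correct answer. An arm of one of the two optimal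
groups, raised by `2 * (a₁ - a₂) + ε`, makes its group dominate the other optimal group by more than
`ε` (`exists_alternative_opt`). An arm of any other group, raised by `a₂`, makes its group Pareto
optimal (`mem_paretoSet_shiftArm`). Both translations are at most three times `Params.gap`, which
bounds the total gap from below (`gap_le_totalGap`). Summing over the arms gives the theorem.

The pull bound avoids divergences and optional stopping. The log-likelihood ratio is truncated at
`-x` with `x` of order `log (1 / δ)`. Above this level, a correct output is unlikely by the PAC
property of the translated environment. Falling below it with few pulls is a large deviation,
bounded by a second change of measure to an arm translated far in the opposite direction. What
remains is the event of many pulls, and Markov's inequality finishes. -/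

instance (A : Algorithm N K D) (ν : Env N K D) : IsProbabilityMeasure (A.law ν) := by
  unfold law; infer_instance

theorem measurable_hist (t : ℕ) : Measurable (hist (N := N) (K := K) (D := D) t) :=
  measurable_pi_lambda _ fun _ => measurable_pi_apply _

theorem law_map_zero (A : Algorithm N K D) (ν : Env N K D) :
    (A.law ν).map (fun ω => ω 0) = A.step ν 0 Fin.elim0 := by
  have h0 : (fun ω : ℕ → Obs N K D => ω 0)
      = (fun x : (i : Finset.Iic 0) → Obs N K D => x ⟨0, by simp⟩)
        ∘ Preorder.frestrictLe (π := fun _ => Obs N K D) 0 := rfl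
  rw [h0, ← Measure.map_map (by fun_prop) (by fun_prop), law, Kernel.trajMeasure,
    Measure.map_comp _ _ (by fun_prop), Kernel.traj_map_frestrictLe, Kernel.partialTraj_self,
    Measure.id_comp, Measure.map_map (by fun_prop) (by fun_prop)]
  exact Measure.map_id

/-- The conditional law of round `t` given the history is given by `step`. -/
theorem lintegral_hist_next (A : Algorithm N K D) (ν : Env N K D) (t : ℕ)
    {f : Hist N K D t × Obs N K D → ℝ≥0∞} (hf : Measurable f) :
    ∫⁻ ω, f (hist t ω, ω t) ∂(A.law ν)
      = ∫⁻ ω, ∫⁻ o, f (hist t ω, o) ∂(A.step ν t (hist t ω)) ∂(A.law ν) := by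
  cases t with
  | zero =>
    -- Round `0` is drawn from the initial measure of the trajectory rather than from a transition
    -- kernel, so it needs separate treatment.
    have h : ∀ ω : ℕ → Obs N K D, hist 0 ω = Fin.elim0 := fun ω => Subsingleton.elim _ _
    simp only [h, lintegral_const, measure_univ, mul_one]
    rw [← law_map_zero A ν, lintegral_map (by fun_prop) (by fun_prop)]
  | succ n =>
    have key := Kernel.map_frestrictLe_trajMeasure_compProd_eq_map_trajMeasure
      (X := fun _ => Obs N K D) (μ₀ := A.step ν 0 Fin.elim0)
      (κ := fun n => (A.step ν (n + 1)).comap (toHist n) (measurable_toHist n)) (a := n)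
    have hg : Measurable fun p : ((s : Finset.Iic n) → Obs N K D) × Obs N K D =>
        f (toHist n p.1, p.2) :=
      hf.comp (((measurable_toHist n).comp measurable_fst).prodMk measurable_snd)
    have h1 := congrArg (fun m => ∫⁻ p, f (toHist n p.1, p.2) ∂m) key
    rw [lintegral_map hg (by fun_prop), Measure.lintegral_compProd hg,
      lintegral_map (hg.lintegral_kernel_prod_right') (by fun_prop)] at h1
    exact h1.symm

/-- Appending round `t` to the history of the first `t` rounds. -/
theorem hist_succ (t : ℕ) (ω : ℕ → Obs N K D) :
    hist (t + 1) ω = Fin.snoc (α := fun _ => Obs N K D) (hist t ω) (ω t) := by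
  funext s
  refine Fin.lastCases ?_ (fun i => ?_) s
  · simp [hist]
  · simp [hist]

theorem measurable_snoc (t : ℕ) : Measurable fun p : Hist N K D t × Obs N K D =>
    (Fin.snoc (α := fun _ => Obs N K D) p.1 p.2 : Hist N K D (t + 1)) := by
  refine measurable_pi_lambda _ fun s => ?_
  refine Fin.lastCases ?_ (fun i => ?_) s
  · simpa using measurable_snd
  · simpa [Function.comp_def] using (measurable_pi_apply i).comp measurable_fst

theorem lintegral_hist_succ (A : Algorithm N K D) (ν : Env N K D) (t : ℕ)
    {f : Hist N K D (t + 1) → ℝ≥0∞} (hf : Measurable f) :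
    ∫⁻ ω, f (hist (t + 1) ω) ∂(A.law ν)
      = ∫⁻ ω, ∫⁻ o, f (Fin.snoc (α := fun _ => Obs N K D) (hist t ω) o)
          ∂(A.step ν t (hist t ω)) ∂(A.law ν) := by
  simp only [hist_succ]
  exact lintegral_hist_next A ν t (hf.comp (measurable_snoc t))

/-! ### Change of measure -/

/-- The likelihood ratio of a history, when the likelihood ratio of one round is `g`. -/
def likelihood (g : Obs N K D → ℝ≥0∞) (t : ℕ) (h : Hist N K D t) : ℝ≥0∞ := ∏ s, g (h s)

theorem measurable_likelihood {g : Obs N K D → ℝ≥0∞} (hg : Measurable g) (t : ℕ) :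
    Measurable (likelihood g t) :=
  Finset.measurable_prod _ fun s _ => hg.comp (measurable_pi_apply s)

theorem lintegral_step_of_density (A : Algorithm N K D) {ν ν' : Env N K D}
    {g : Obs N K D → ℝ≥0∞} (hg : Measurable g)
    (hν : ∀ i j, (ν' i j : Measure (Fin D → ℝ))
      = (ν i j : Measure (Fin D → ℝ)).withDensity fun x => g ((i, j), x))
    (t : ℕ) (h : Hist N K D t) {f : Obs N K D → ℝ≥0∞} (hf : Measurable f) :
    ∫⁻ o, f o ∂(A.step ν' t h) = ∫⁻ o, f o * g o ∂(A.step ν t h) := by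
  unfold step
  rw [Kernel.lintegral_compProd _ _ _ hf,
    Kernel.lintegral_compProd _ _ _ (f := fun o => f o * g o) (hf.mul hg)]
  refine lintegral_congr fun a => ?_
  simp only [Kernel.prodMkLeft_apply]
  change ∫⁻ x, f (a, x) ∂(ν' a.1 a.2 : Measure (Fin D → ℝ))
    = ∫⁻ x, f (a, x) * g (a, x) ∂(ν a.1 a.2 : Measure (Fin D → ℝ))
  rw [hν, lintegral_withDensity_eq_lintegral_mul _ (by fun_prop) (by fun_prop)]
  refine lintegral_congr fun x => ?_
  simp [mul_comm]

/-- The sampling rule is the same in both environments and cancels, so only the reward densities of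
the pulled arms remain. The induction integrates out the last round. -/
theorem lintegral_hist_of_density (A : Algorithm N K D) {ν ν' : Env N K D}
    {g : Obs N K D → ℝ≥0∞} (hg : Measurable g)
    (hν : ∀ i j, (ν' i j : Measure (Fin D → ℝ))
      = (ν i j : Measure (Fin D → ℝ)).withDensity fun x => g ((i, j), x))
    (t : ℕ) {f : Hist N K D t → ℝ≥0∞} (hf : Measurable f) :
    ∫⁻ ω, f (hist t ω) ∂(A.law ν')
      = ∫⁻ ω, f (hist t ω) * likelihood g t (hist t ω) ∂(A.law ν) := by
  induction t with
  | zero =>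
    have h : ∀ ω : ℕ → Obs N K D, hist 0 ω = Fin.elim0 := fun ω => Subsingleton.elim _ _
    simp [h, likelihood]
  | succ t ih =>
    have hsn : ∀ h : Hist N K D t, Measurable fun o : Obs N K D =>
        (Fin.snoc (α := fun _ => Obs N K D) h o : Hist N K D (t + 1)) :=
      fun h => (measurable_snoc t).comp measurable_prodMk_left
    have hF : Measurable fun h : Hist N K D t =>
        ∫⁻ o, f (Fin.snoc (α := fun _ => Obs N K D) h o) ∂(A.step ν' t h) :=
      (hf.comp (measurable_snoc t)).lintegral_kernel_prod_right'
    rw [lintegral_hist_succ A ν' t hf, ih hF,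
      lintegral_hist_succ A ν t (f := fun h => f h * likelihood g (t + 1) h)
        (hf.mul (measurable_likelihood hg _))]
    refine lintegral_congr fun ω => ?_
    have hfs : Measurable fun o : Obs N K D =>
        f (Fin.snoc (α := fun _ => Obs N K D) (hist t ω) o) := hf.comp (hsn _)
    rw [lintegral_step_of_density A hg hν t _ hfs, ← lintegral_mul_const _ (by fun_prop)]
    refine lintegral_congr fun o => ?_
    simp only [likelihood, Fin.prod_univ_castSucc, Fin.snoc_castSucc, Fin.snoc_last]
    ring

/-- Comparison of the probabilities of a union of disjoint events, the `t`-th of which depends on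
the history of the first `t` rounds only. -/
theorem law_iUnion_le (A : Algorithm N K D) {ν ν' : Env N K D}
    {g : Obs N K D → ℝ≥0∞} (hg : Measurable g)
    (hν : ∀ i j, (ν' i j : Measure (Fin D → ℝ))
      = (ν i j : Measure (Fin D → ℝ)).withDensity fun x => g ((i, j), x))
    {B : (t : ℕ) → Set (Hist N K D t)} (hB : ∀ t, MeasurableSet (B t))
    (hdisj : Pairwise (Function.onFun Disjoint fun t => hist t ⁻¹' B t)) {C : ℝ≥0∞}
    (hC : ∀ t, ∀ h ∈ B t, 1 ≤ C * likelihood g t h) :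
    A.law ν (⋃ t, hist t ⁻¹' B t) ≤ C * A.law ν' (⋃ t, hist t ⁻¹' B t) := by
  have hm : ∀ t, MeasurableSet (hist t ⁻¹' B t) := fun t => measurable_hist t (hB t)
  -- On the `t`-th piece the density is that of the first `t` rounds. Slicing by round thus gives
  -- the change of measure at a random time from fixed times alone.
  rw [measure_iUnion hdisj hm, measure_iUnion hdisj hm, ← ENNReal.tsum_mul_left]
  refine ENNReal.tsum_le_tsum fun t => ?_
  have hi : ∀ μ : Measure (ℕ → Obs N K D), μ (hist t ⁻¹' B t)
      = ∫⁻ ω, (B t).indicator 1 (hist t ω) ∂μ := fun μ => by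
    rw [← lintegral_indicator_one (hm t)]; rfl
  have hmi : Measurable ((B t).indicator (1 : Hist N K D t → ℝ≥0∞)) :=
    measurable_one.indicator (hB t)
  have hmm : Measurable fun ω : ℕ → Obs N K D =>
      (B t).indicator (1 : Hist N K D t → ℝ≥0∞) (hist t ω) * likelihood g t (hist t ω) :=
    (hmi.mul (measurable_likelihood hg t)).comp (measurable_hist t)
  rw [hi, hi, lintegral_hist_of_density A hg hν t hmi, ← lintegral_const_mul _ hmm]
  refine lintegral_mono fun ω => ?_
  by_cases h : hist t ω ∈ B t
  · simpa [h] using hC t _ h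
  · simp [h]

/-! ### The stopping time -/

/-- The histories after which `A` stops, and not earlier. -/
def firstStop (A : Algorithm N K D) (t : ℕ) : Set (Hist N K D t) :=
  {h | h ∈ A.stopSet t ∧ ∀ s : Fin t, (fun i => h (Fin.castLE s.2.le i)) ∉ A.stopSet s}

theorem measurableSet_firstStop (A : Algorithm N K D) (t : ℕ) :
    MeasurableSet (A.firstStop t) := by
  have h : A.firstStop t = A.stopSet t ∩ ⋂ s : Fin t,
      ((fun h : Hist N K D t => fun i => h (Fin.castLE s.2.le i)) ⁻¹' A.stopSet s)ᶜ := by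
    ext; simp [firstStop]
  rw [h]
  refine (A.measurableSet_stopSet t).inter (MeasurableSet.iInter fun s => ?_)
  have hr : Measurable fun (h : Hist N K D t) (i : Fin (s : ℕ)) => h (Fin.castLE s.2.le i) :=
    measurable_pi_lambda _ fun i => measurable_pi_apply _
  exact (hr (A.measurableSet_stopSet s)).compl

theorem hist_mem_firstStop_iff (A : Algorithm N K D) (t : ℕ) (ω : ℕ → Obs N K D) :
    hist t ω ∈ A.firstStop t ↔ A.stopTime ω = t := by
  have hr : ∀ s : Fin t, (fun i => hist t ω (Fin.castLE s.2.le i)) = hist s ω := fun s => rfl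
  simp only [firstStop, Set.mem_ofPred_eq, hr]
  constructor
  · rintro ⟨h, h'⟩
    refine le_antisymm (iInf₂_le t h) (le_iInf₂ fun s hs => ?_)
    by_contra! hlt
    exact h' ⟨s, by exact_mod_cast hlt⟩ hs
  · intro h
    have hs : ∀ s : Fin t, hist s ω ∉ A.stopSet s := fun s hs => by
      have h1 : A.stopTime ω ≤ s := iInf₂_le (s : ℕ) hs
      rw [h] at h1
      have := s.2
      have h2 : t ≤ (s : ℕ) := by exact_mod_cast h1
      omega
    refine ⟨?_, hs⟩
    by_contra hn
    have : ((t + 1 : ℕ) : ℕ∞) ≤ A.stopTime ω := le_iInf₂ fun s h2 => by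
      by_contra! hlt
      have : s < t + 1 := by exact_mod_cast hlt
      rcases Nat.lt_succ_iff_lt_or_eq.1 this with h3 | rfl
      · exact hs ⟨s, h3⟩ h2
      · exact hn h2
    rw [h] at this
    have : t + 1 ≤ t := by exact_mod_cast this
    omega

theorem measurable_stopTime (A : Algorithm N K D) : Measurable A.stopTime := by
  have h : ∀ t : ℕ, MeasurableSet (A.stopTime ⁻¹' {(t : ℕ∞)}) := fun t => by
    have : A.stopTime ⁻¹' {(t : ℕ∞)} = hist t ⁻¹' A.firstStop t := by
      ext ω; simp [hist_mem_firstStop_iff]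
    rw [this]
    exact measurable_hist t (A.measurableSet_firstStop t)
  refine measurable_to_countable' fun x => ?_
  induction x using ENat.recTopCoe with
  | coe t => exact h t
  | top =>
    have : A.stopTime ⁻¹' {⊤} = (⋃ t : ℕ, A.stopTime ⁻¹' {(t : ℕ∞)})ᶜ := by
      ext ω
      simp [ENat.eq_top_iff_forall_ne, ne_comm]
    rw [this]
    exact (MeasurableSet.iUnion h).compl

/-- The number of pulls of the arm `a` in a history. -/
def pullCount (a : Fin N × Fin K) (t : ℕ) (h : Hist N K D t) : ℕ :=
  ∑ s, if (h s).1 = a then 1 else 0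

theorem measurable_pullCount (a : Fin N × Fin K) (t : ℕ) :
    Measurable (pullCount (D := D) a t) := by
  refine Finset.measurable_sum _ fun s _ => ?_
  refine Measurable.ite ?_ measurable_const measurable_const
  exact (measurable_fst.comp (measurable_pi_apply s)) (measurableSet_singleton a)

theorem sum_pullCount (t : ℕ) (h : Hist N K D t) :
    ∑ i, ∑ j, pullCount (i, j) t h = t := by
  rw [← Fintype.sum_prod_type']
  simp only [pullCount]
  rw [Finset.sum_comm]
  simp

/-- The number of pulls of the arm `a` until the algorithm stops. -/
def stoppedCount (A : Algorithm N K D) (a : Fin N × Fin K) (ω : ℕ → Obs N K D) : ℕ :=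
  pullCount a (A.stopTime ω).toNat (hist (A.stopTime ω).toNat ω)

theorem measurable_stoppedCount (A : Algorithm N K D) (a : Fin N × Fin K) :
    Measurable (A.stoppedCount a) := by
  have h : Measurable fun p : ℕ × (ℕ → Obs N K D) => pullCount a p.1 (hist p.1 p.2) :=
    measurable_from_prod_countable_right fun t => (measurable_pullCount a t).comp (measurable_hist t)
  have h2 : Measurable fun ω => (A.stopTime ω).toNat :=
    (Measurable.of_discrete (f := ENat.toNat)).comp A.measurable_stopTime
  exact h.comp (h2.prodMk measurable_id)

theorem sum_lintegral_stoppedCount_le (A : Algorithm N K D) (ν : Env N K D) :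
    ∑ i, ∑ j, ∫⁻ ω, (A.stoppedCount (i, j) ω : ℝ≥0∞) ∂(A.law ν) ≤ A.expectedSamples ν := by
  have hm : ∀ a, Measurable fun ω => (A.stoppedCount a ω : ℝ≥0∞) := fun a =>
    (Measurable.of_discrete (f := fun n : ℕ => (n : ℝ≥0∞))).comp (A.measurable_stoppedCount a)
  simp_rw [← lintegral_finsetSum _ fun j _ => hm (_, j)]
  rw [← lintegral_finsetSum _ fun i _ => Finset.measurable_sum _ fun j _ => hm (i, j)]
  refine lintegral_mono fun ω => ?_
  have h := sum_pullCount (A.stopTime ω).toNat (hist (A.stopTime ω).toNat ω)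
  have h' : ∑ i, ∑ j, (A.stoppedCount (i, j) ω : ℝ≥0∞) = ((A.stopTime ω).toNat : ℝ≥0∞) := by
    exact_mod_cast congrArg (fun n : ℕ => (n : ℝ≥0∞)) h
  rw [h']
  -- Only an inequality: on trajectories that never stop, `toNat` is `0` and all stopped counts
  -- vanish.
  have h3 : (((A.stopTime ω).toNat : ℕ∞) : ℝ≥0∞) ≤ (A.stopTime ω : ℝ≥0∞) := by
    exact_mod_cast ENat.natCast_toNat_le_self _
  simpa using h3

end Algorithm

/-! ### Shifting one arm of a Gaussian environment -/

theorem gaussianReal_withDensity_shift (m r : ℝ) :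
    (gaussianReal m 1).withDensity
        (fun z => ENNReal.ofReal (Real.exp (r * (z - m) - r ^ 2 / 2)))
      = gaussianReal (m + r) 1 := by
  rw [gaussianReal_of_var_ne_zero _ one_ne_zero, gaussianReal_of_var_ne_zero _ one_ne_zero,
    ← withDensity_mul _ (measurable_gaussianPDF _ _) (by fun_prop)]
  congr 1
  funext z
  simp only [Pi.mul_apply, gaussianPDF, gaussianPDFReal]
  rw [← ENNReal.ofReal_mul (by positivity), mul_assoc, ← Real.exp_add]
  congr 3
  simp
  ring

/-- Translation of all components of a reward vector by `r`. -/
def translate (r : ℝ) (x : Fin D → ℝ) : Fin D → ℝ := fun d => x d + r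

theorem measurable_translate (r : ℝ) : Measurable (translate (D := D) r) := by
  unfold translate; fun_prop

/-- The environment in which the rewards of the arm `a` are translated by `r`. -/
def shiftArm (ν : Env N K D) (a : Fin N × Fin K) (r : ℝ) : Env N K D := fun i j =>
  if (i, j) = a then (ν i j).map (measurable_translate r).aemeasurable else ν i j

/-- The likelihood ratio of one round between an environment and the one with the arm `a`
translated by `r`, if component `d` of the reward of `a` has mean `m`. -/
def shiftDensity (a : Fin N × Fin K) (d : Fin D) (m r : ℝ) (o : Obs N K D) : ℝ≥0∞ :=
  if o.1 = a then ENNReal.ofReal (Real.exp (r * (o.2 d - m) - r ^ 2 / 2)) else 1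

theorem measurable_shiftDensity (a : Fin N × Fin K) (d : Fin D) (m r : ℝ) :
    Measurable (shiftDensity a d m r) := by
  unfold shiftDensity
  refine Measurable.ite (measurable_fst (measurableSet_singleton a)) ?_ measurable_const
  fun_prop

variable {ν : Env N K D}

theorem shiftArm_of_ne {a : Fin N × Fin K} {i : Fin N} {j : Fin K} (h : (i, j) ≠ a) (r : ℝ) :
    shiftArm ν a r i j = ν i j := if_neg h

theorem coe_shiftArm_self (i : Fin N) (j : Fin K) (r : ℝ) :
    (shiftArm ν (i, j) r i j : Measure (Fin D → ℝ))
      = (ν i j : Measure (Fin D → ℝ)).map (translate r) := by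
  simp [shiftArm]

/-- One component determines the others almost surely, so the reward law is the image of a
one-dimensional Gaussian under an affine embedding. -/
theorem IsFullyDependentGaussian.eq_map (h : IsFullyDependentGaussian ν) (i : Fin N) (j : Fin K)
    (d : Fin D) : (ν i j : Measure (Fin D → ℝ))
      = (gaussianReal (armMean ν i j d) 1).map
          fun z d' => z + (armMean ν i j d' - armMean ν i j d) := by
  rw [← h.gaussian i j d, Measure.map_map (by fun_prop) (by fun_prop)]
  conv_lhs => rw [← Measure.map_id (μ := (ν i j : Measure (Fin D → ℝ)))]
  refine Measure.map_congr ?_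
  filter_upwards [ae_all_iff.2 fun d' => h.dependent i j d' d] with x hx
  funext d'
  exact hx d'

/-- Translation along the diagonal commutes with the affine embedding of the line that carries the
reward. The density is therefore the one-dimensional one, read off any single component `d`. -/
theorem IsFullyDependentGaussian.shiftArm_eq_withDensity (h : IsFullyDependentGaussian ν)
    (i : Fin N) (j : Fin K) (d : Fin D) (r : ℝ) (i' : Fin N) (j' : Fin K) :
    (shiftArm ν (i, j) r i' j' : Measure (Fin D → ℝ))
      = (ν i' j' : Measure (Fin D → ℝ)).withDensity
          fun x => shiftDensity (i, j) d (armMean ν i j d) r ((i', j'), x) := by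
  by_cases hij : (i', j') = (i, j)
  · obtain ⟨rfl, rfl⟩ := Prod.mk.inj hij
    set m := armMean ν i' j' d
    set φ : ℝ → Fin D → ℝ := fun z d' => z + (armMean ν i' j' d' - m)
    have hφ : Measurable φ := by fun_prop
    have hmap : (ν i' j' : Measure (Fin D → ℝ)) = (gaussianReal m 1).map φ := h.eq_map i' j' d
    have hcomm : translate r ∘ φ = φ ∘ fun z => z + r := by
      funext z d'; simp only [translate, φ, Function.comp]; ring
    rw [coe_shiftArm_self, hmap, Measure.map_map (measurable_translate r) hφ, hcomm,
      ← Measure.map_map hφ (by fun_prop), gaussianReal_map_add_const,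
      ← gaussianReal_withDensity_shift]
    ext s hs
    have hg : Measurable fun x : Fin D → ℝ => shiftDensity (i', j') d m r ((i', j'), x) :=
      (measurable_shiftDensity _ _ _ _).comp measurable_prodMk_left
    rw [Measure.map_apply hφ hs, withDensity_apply _ (hφ hs), withDensity_apply _ hs,
      setLIntegral_map hs hg hφ]
    simp [shiftDensity, φ, m]
  · rw [shiftArm_of_ne hij]
    simp [shiftDensity, hij]

theorem integral_coord_of_gaussian {μ : Measure (Fin D → ℝ)} {d : Fin D} {m : ℝ}
    (h : μ.map (fun x => x d) = gaussianReal m 1) : ∫ x, x d ∂μ = m := by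
  rw [← integral_map (f := fun z : ℝ => z) (φ := fun x : Fin D → ℝ => x d)
    (measurable_pi_apply d).aemeasurable (by fun_prop),
    h, integral_id_gaussianReal]

theorem isAdmissible_of_gaussian {b : ℝ} {m : Fin N → Fin K → Fin D → ℝ}
    (h : ∀ i j d, (ν i j : Measure (Fin D → ℝ)).map (fun x => x d) = gaussianReal (m i j d) 1)
    (hm : ∀ i j d, m i j d ∈ Set.Icc 0 b) : IsAdmissible b ν := by
  intro i j d
  have hmean : armMean ν i j d = m i j d := integral_coord_of_gaussian (h i j d)
  rw [hmean]
  refine ⟨?_, hm i j d⟩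
  have hX : (ν i j : Measure (Fin D → ℝ)).map (fun x => x d - m i j d) = gaussianReal 0 1 := by
    have := gaussianReal_map_sub_const (μ := m i j d) (v := 1) (m i j d)
    rw [← h i j d, Measure.map_map (by fun_prop) (by fun_prop), sub_self] at this
    exact this
  refine ⟨fun t => ?_, fun t => ?_⟩
  · have h1 : Integrable (fun z => Real.exp (t * z))
        ((ν i j : Measure (Fin D → ℝ)).map (fun x => x d - m i j d)) := by
      rw [hX]; exact integrable_exp_mul_gaussianReal t
    exact h1.comp_measurable (by fun_prop)
  · rw [mgf_gaussianReal hX]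
    simp

theorem IsFullyDependentGaussian.map_shiftArm (h : IsFullyDependentGaussian ν)
    (a : Fin N × Fin K) (r : ℝ) (i : Fin N) (j : Fin K) (d : Fin D) :
    (shiftArm ν a r i j : Measure (Fin D → ℝ)).map (fun x => x d)
      = gaussianReal (armMean ν i j d + if (i, j) = a then r else 0) 1 := by
  by_cases hij : (i, j) = a
  · subst hij
    rw [coe_shiftArm_self, Measure.map_map (by fun_prop) (measurable_translate r), if_pos rfl,
      ← gaussianReal_map_add_const, ← h.gaussian i j d,
      Measure.map_map (by fun_prop) (by fun_prop)]
    rfl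
  · rw [shiftArm_of_ne hij, h.gaussian, if_neg hij, add_zero]

theorem IsFullyDependentGaussian.armMean_shiftArm (h : IsFullyDependentGaussian ν)
    (a : Fin N × Fin K) (r : ℝ) (i : Fin N) (j : Fin K) (d : Fin D) :
    armMean (shiftArm ν a r) i j d = armMean ν i j d + if (i, j) = a then r else 0 :=
  integral_coord_of_gaussian (h.map_shiftArm a r i j d)

/-! ### The likelihood ratio of a history -/

namespace Algorithm

/-- The sum of the centred component `d` of the rewards of the arm `a` in a history. -/
def deviation (a : Fin N × Fin K) (d : Fin D) (m : ℝ) (t : ℕ) (h : Hist N K D t) : ℝ :=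
  ∑ s, if (h s).1 = a then (h s).2 d - m else 0

theorem measurable_deviation (a : Fin N × Fin K) (d : Fin D) (m : ℝ) (t : ℕ) :
    Measurable (deviation (N := N) (K := K) a d m t) := by
  refine Finset.measurable_sum _ fun s _ => ?_
  refine Measurable.ite ?_ (by fun_prop) measurable_const
  exact (measurable_fst.comp (measurable_pi_apply s)) (measurableSet_singleton a)

theorem likelihood_shiftDensity (a : Fin N × Fin K) (d : Fin D) (m r : ℝ) (t : ℕ)
    (h : Hist N K D t) :
    likelihood (shiftDensity a d m r) t h
      = ENNReal.ofReal (Real.exp (r * deviation a d m t h - r ^ 2 / 2 * pullCount a t h)) := by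
  have h1 : r * deviation a d m t h - r ^ 2 / 2 * pullCount a t h
      = ∑ s, if (h s).1 = a then r * ((h s).2 d - m) - r ^ 2 / 2 else 0 := by
    simp only [deviation, pullCount, Nat.cast_sum, Finset.mul_sum, ← Finset.sum_sub_distrib]
    refine Finset.sum_congr rfl fun s _ => ?_
    split_ifs <;> simp
  rw [h1, Real.exp_sum, ENNReal.ofReal_prod_of_nonneg fun _ _ => (Real.exp_pos _).le, likelihood]
  refine Finset.prod_congr rfl fun s _ => ?_
  unfold shiftDensity
  split_ifs <;> simp


theorem pairwise_disjoint_firstStop (A : Algorithm N K D) {B : (t : ℕ) → Set (Hist N K D t)}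
    (hB : ∀ t, B t ⊆ A.firstStop t) :
    Pairwise (Function.onFun Disjoint fun t => hist t ⁻¹' B t) := by
  intro s t hst
  refine Set.disjoint_left.2 fun ω hs ht => hst ?_
  have h1 := (A.hist_mem_firstStop_iff s ω).1 (hB s hs)
  have h2 := (A.hist_mem_firstStop_iff t ω).1 (hB t ht)
  exact_mod_cast h1.symm.trans h2

theorem output_eq (A : Algorithm N K D) {t : ℕ} {ω : ℕ → Obs N K D} (h : A.stopTime ω = t) :
    A.output ω = A.recommend t (hist t ω) := by
  have h' : (A.stopTime ω).toNat = t := by simp [h]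
  simp only [output]
  rw [h']

theorem stoppedCount_eq (A : Algorithm N K D) (a : Fin N × Fin K) {t : ℕ} {ω : ℕ → Obs N K D}
    (h : A.stopTime ω = t) : A.stoppedCount a ω = pullCount a t (hist t ω) := by
  have h' : (A.stopTime ω).toNat = t := by simp [h]
  simp only [stoppedCount]
  rw [h']

/-- The point at which the log-likelihood ratio is truncated, and its properties. -/
theorem exists_truncation {δ : ℝ} (hδ : 0 < δ) (hδ' : 2.4 * δ ≤ 1) :
    ∃ x : ℝ, 0 < x ∧ Real.log (1 / (2.4 * δ)) / 2 ≤ x ∧ Real.exp x * δ ≤ 1 / 2 ∧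
      Real.exp (-(24 * x)) ≤ 1 / 24 := by
  set y := Real.log (1 / (2.4 * δ)) with hy
  have hinv : 1 ≤ 1 / (2.4 * δ) := by rw [le_div_iff₀ (by positivity)]; linarith
  have hy0 : 0 ≤ y := Real.log_nonneg hinv
  have hl : (1 : ℝ) / 6 ≤ Real.log 1.2 := by
    have := Real.one_sub_inv_le_log_of_pos (x := 1.2) (by norm_num)
    norm_num at this ⊢; linarith
  -- With `q = exp (y / 2) ≥ 1` and `q ^ 2 * 2.4 * δ = 1`, one gets `exp x * δ = 1.2 * q * δ = 1 /
  -- (2 * q)`. The summand `log 1.2 ≥ 1 / 6` keeps `24 * x ≥ 4` even if `y = 0`.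
  refine ⟨y / 2 + Real.log 1.2, by linarith, by linarith, ?_, ?_⟩
  · rw [Real.exp_add, Real.exp_log (by norm_num)]
    have hq : Real.exp (y / 2) * Real.exp (y / 2) = 1 / (2.4 * δ) := by
      rw [← Real.exp_add, add_halves, hy, Real.exp_log (by positivity)]
    have hq1 : 1 ≤ Real.exp (y / 2) := Real.one_le_exp (by linarith)
    set q := Real.exp (y / 2)
    have h1 : q * q * (2.4 * δ) = 1 := by rw [hq]; field_simp
    nlinarith [mul_pos (lt_of_lt_of_le one_pos hq1) hδ]
  · have h4 : Real.exp (-(24 * (y / 2 + Real.log 1.2))) ≤ Real.exp (-4) :=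
      Real.exp_le_exp.2 (by linarith)
    refine h4.trans ?_
    have h5 : Real.exp 4 = Real.exp 1 ^ 4 := by rw [← Real.exp_nat_mul]; norm_num
    have h6 : (2.7 : ℝ) ^ 4 ≤ Real.exp 1 ^ 4 := by
      have := Real.exp_one_gt_d9
      gcongr; linarith
    rw [Real.exp_neg, h5, one_div]
    exact inv_anti₀ (by norm_num) (le_trans (by norm_num) h6)

/-- If the output has a property with probability at least `1 - δ` in `ν`, and with probability at
most `δ` in the environment in which one arm is translated by `s`, then this arm is pulled often
in `ν`. -/
theorem le_lintegral_stoppedCount (A : Algorithm N K D) {ν : Env N K D}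
    (hν : IsFullyDependentGaussian ν) (hD : 0 < D) (i : Fin N) (j : Fin K) {s : ℝ} (hs : 0 < s)
    {δ : ℝ} (hδ : 0 < δ) (hδ' : 2.4 * δ ≤ 1) {P : Set (Fin N) → Prop}
    (hP : ∀ t, MeasurableSet {h | P (A.recommend t h)})
    (hτ : ∀ᵐ ω ∂(A.law ν), A.stopTime ω < ⊤)
    (h1 : A.law ν {ω | A.stopTime ω < ⊤ ∧ ¬ P (A.output ω)} ≤ ENNReal.ofReal δ)
    (h2 : A.law (shiftArm ν (i, j) s) {ω | A.stopTime ω < ⊤ ∧ P (A.output ω)}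
      ≤ ENNReal.ofReal δ) :
    ENNReal.ofReal (Real.log (1 / (2.4 * δ)) / (2352 * s ^ 2))
      ≤ ∫⁻ ω, (A.stoppedCount (i, j) ω : ℝ≥0∞) ∂(A.law ν) := by
  obtain ⟨x, hx0, hx, hx1, hx2⟩ := exists_truncation hδ hδ'
  set d : Fin D := ⟨0, hD⟩
  set m := armMean ν i j d
  set W := fun t (h : Hist N K D t) => deviation (i, j) d m t h
  set n := fun t (h : Hist N K D t) => (pullCount (i, j) t h : ℝ)
  have hW : ∀ t, Measurable (W t) := fun t => measurable_deviation _ _ _ t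
  have hn : ∀ t, Measurable (n t) := fun t =>
    (Measurable.of_discrete (f := fun k : ℕ => (k : ℝ))).comp (measurable_pullCount _ t)
  -- Here `s * W - s ^ 2 / 2 * n` is the log-likelihood ratio of the translated environment to `ν`.
  -- A run that stops with property `P` has ratio at least `-x` (`S₁`), or a smaller ratio with few
  -- pulls (`S₂`), or many pulls (`S₃`).
  set B₁ := fun t => A.firstStop t ∩ {h | P (A.recommend t h)} ∩
    {h | -x ≤ s * W t h - s ^ 2 / 2 * n t h}
  set B₂ := fun t => A.firstStop t ∩ ({h | s ^ 2 * n t h ≤ x / 49} ∩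
    {h | s * W t h - s ^ 2 / 2 * n t h < -x})
  set S₁ := ⋃ t, hist t ⁻¹' B₁ t
  set S₂ := ⋃ t, hist t ⁻¹' B₂ t
  set S₃ := {ω : ℕ → Obs N K D |
    ENNReal.ofReal (x / (49 * s ^ 2)) ≤ (A.stoppedCount (i, j) ω : ℝ≥0∞)}
  have hfirst : ∀ ω : ℕ → Obs N K D, A.stopTime ω < ⊤ → ∃ t : ℕ,
      hist t ω ∈ A.firstStop t ∧ A.output ω = A.recommend t (hist t ω) ∧
        A.stoppedCount (i, j) ω = pullCount (i, j) t (hist t ω) := fun ω h => by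
    obtain ⟨t, ht⟩ := ENat.ne_top_iff_exists.1 h.ne
    exact ⟨t, (A.hist_mem_firstStop_iff t ω).2 ht.symm, A.output_eq ht.symm,
      A.stoppedCount_eq _ ht.symm⟩
  have hcover : (Set.univ : Set (ℕ → Obs N K D)) ⊆
      {ω | ¬ A.stopTime ω < ⊤} ∪ ({ω | A.stopTime ω < ⊤ ∧ ¬ P (A.output ω)} ∪
        (S₁ ∪ (S₂ ∪ S₃))) := fun ω _ => by
    by_cases h : A.stopTime ω < ⊤
    swap
    · exact Or.inl h
    by_cases hp : P (A.output ω)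
    swap
    · exact Or.inr (Or.inl ⟨h, hp⟩)
    obtain ⟨t, ht, ho, hc⟩ := hfirst ω h
    refine Or.inr (Or.inr ?_)
    by_cases hc1 : -x ≤ s * W t (hist t ω) - s ^ 2 / 2 * n t (hist t ω)
    · exact Or.inl (Set.mem_iUnion.2 ⟨t, ⟨ht, by rw [ho] at hp; exact hp⟩, hc1⟩)
    by_cases hc2 : s ^ 2 * n t (hist t ω) ≤ x / 49
    · exact Or.inr (Or.inl (Set.mem_iUnion.2 ⟨t, ht, hc2, not_le.1 hc1⟩))
    · refine Or.inr (Or.inr ?_)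
      change ENNReal.ofReal (x / (49 * s ^ 2)) ≤ (A.stoppedCount (i, j) ω : ℝ≥0∞)
      rw [hc, ← ENNReal.ofReal_natCast]
      refine ENNReal.ofReal_le_ofReal ?_
      rw [div_le_iff₀ (by positivity)]
      have := not_le.1 hc2
      simp only [n] at this
      linarith
  have hS₁ : A.law ν S₁ ≤ ENNReal.ofReal (1 / 2) := by
    calc A.law ν S₁ ≤ ENNReal.ofReal (Real.exp x) * A.law (shiftArm ν (i, j) s) S₁ := by
          refine A.law_iUnion_le (measurable_shiftDensity (i, j) d m s)
            (hν.shiftArm_eq_withDensity i j d s) (fun t => ?_)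
            (A.pairwise_disjoint_firstStop fun t h hh => hh.1.1) fun t h hh => ?_
          · exact ((A.measurableSet_firstStop t).inter (hP t)).inter
              (measurableSet_le measurable_const
                (((hW t).const_mul _).sub ((hn t).const_mul _)))
          · rw [likelihood_shiftDensity, ← ENNReal.ofReal_mul (Real.exp_pos _).le,
              ← Real.exp_add, ENNReal.one_le_ofReal, Real.one_le_exp_iff]
            have : -x ≤ s * W t h - s ^ 2 / 2 * n t h := hh.2
            simp only [W, n] at this
            linarith
      _ ≤ ENNReal.ofReal (Real.exp x) * ENNReal.ofReal δ := by
          gcongr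
          refine (measure_mono fun ω hω => ?_).trans h2
          obtain ⟨t, ⟨ht, hp⟩, -⟩ := Set.mem_iUnion.1 hω
          have ht' := (A.hist_mem_firstStop_iff t ω).1 ht
          refine ⟨by simp [ht'], ?_⟩
          rw [A.output_eq ht']
          exact hp
      _ ≤ ENNReal.ofReal (1 / 2) := by
          rw [← ENNReal.ofReal_mul (Real.exp_pos _).le]
          exact ENNReal.ofReal_le_ofReal hx1
  -- Translation by `-48 * s` is an exponential tilt. On `S₂` its log-likelihood ratio is `-48 * s *
  -- W - 1152 * s ^ 2 * n`, at least `48 * x - 1176 * s ^ 2 * n ≥ 24 * x` because `1176 / 49 = 24`.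
  -- This environment need not be admissible: only the trivial bound `1` is used there.
  have hS₂ : A.law ν S₂ ≤ ENNReal.ofReal (1 / 24) := by
    calc A.law ν S₂
        ≤ ENNReal.ofReal (Real.exp (-(24 * x))) * A.law (shiftArm ν (i, j) (-(48 * s))) S₂ := by
          refine A.law_iUnion_le (measurable_shiftDensity (i, j) d m _)
            (hν.shiftArm_eq_withDensity i j d _) (fun t => ?_)
            (A.pairwise_disjoint_firstStop fun t h hh => hh.1) fun t h hh => ?_
          · exact (A.measurableSet_firstStop t).inter
              ((measurableSet_le ((hn t).const_mul _) measurable_const).inter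
                (measurableSet_lt (((hW t).const_mul _).sub ((hn t).const_mul _))
                  measurable_const))
          · rw [likelihood_shiftDensity, ← ENNReal.ofReal_mul (Real.exp_pos _).le,
              ← Real.exp_add, ENNReal.one_le_ofReal, Real.one_le_exp_iff]
            have ha : s ^ 2 * n t h ≤ x / 49 := hh.2.1
            have hb : s * W t h - s ^ 2 / 2 * n t h < -x := hh.2.2
            simp only [W, n] at ha hb
            nlinarith
      _ ≤ ENNReal.ofReal (1 / 24) * 1 := by
          gcongr
          exact prob_le_one
      _ = ENNReal.ofReal (1 / 24) := mul_one _
  -- The other events have total mass at most `5 / 12 + 1 / 2 + 1 / 24 = 23 / 24`, where `δ ≤ 5 /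
  -- 12` is the condition `2.4 * δ ≤ 1`.
  have hS₃ : ENNReal.ofReal (1 / 24) ≤ A.law ν S₃ := by
    have h0 : A.law ν {ω | ¬ A.stopTime ω < ⊤} = 0 := hτ
    have hδ'' : ENNReal.ofReal δ ≤ ENNReal.ofReal (5 / 12) :=
      ENNReal.ofReal_le_ofReal (by norm_num at hδ'; linarith)
    have htot : 1 ≤ 0 + (ENNReal.ofReal (5 / 12) + (ENNReal.ofReal (1 / 2) +
        (ENNReal.ofReal (1 / 24) + A.law ν S₃))) := by
      calc 1 = A.law ν Set.univ := measure_univ.symm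
        _ ≤ _ := (measure_mono hcover).trans (measure_union_le _ _)
        _ ≤ _ := by
          refine add_le_add h0.le ((measure_union_le _ _).trans
            (add_le_add (h1.trans hδ'') ((measure_union_le _ _).trans
              (add_le_add hS₁ ((measure_union_le _ _).trans (add_le_add hS₂ le_rfl))))))
    rw [zero_add, ← add_assoc, ← add_assoc, ← ENNReal.ofReal_add (by norm_num) (by norm_num),
      ← ENNReal.ofReal_add (by norm_num) (by norm_num)] at htot
    have h24 : (1 : ℝ≥0∞) = ENNReal.ofReal (5 / 12 + 1 / 2 + 1 / 24) + ENNReal.ofReal (1 / 24) := by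
      rw [← ENNReal.ofReal_add (by norm_num) (by norm_num)]; norm_num
    rw [h24] at htot
    exact (ENNReal.add_le_add_iff_left ENNReal.ofReal_ne_top).1 htot
  have hmeas : Measurable fun ω => (A.stoppedCount (i, j) ω : ℝ≥0∞) :=
    (Measurable.of_discrete (f := fun n : ℕ => (n : ℝ≥0∞))).comp (A.measurable_stoppedCount _)
  -- Markov's inequality for `S₃`. With `x` at least half the logarithm, the constant is `2 * 49 *
  -- 24 = 2352`.
  calc ENNReal.ofReal (Real.log (1 / (2.4 * δ)) / (2352 * s ^ 2))
      ≤ ENNReal.ofReal (x / (49 * s ^ 2) * (1 / 24)) := by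
        refine ENNReal.ofReal_le_ofReal ?_
        rw [div_mul_div_comm, div_le_div_iff₀ (by positivity) (by positivity)]
        have := sq_nonneg s
        nlinarith
    _ = ENNReal.ofReal (x / (49 * s ^ 2)) * ENNReal.ofReal (1 / 24) :=
        ENNReal.ofReal_mul (by positivity)
    _ ≤ ENNReal.ofReal (x / (49 * s ^ 2)) * A.law ν S₃ := by gcongr
    _ ≤ _ := mul_meas_ge_le_lintegral hmeas _

end Algorithm

/-! ### The Pareto sets and gaps of the class -/

namespace Params.IsValid

variable {b : ℝ} {p : Params}

theorem eff_le (hp : p.IsValid b) (i : Fin N) (d : Fin D) (hd : d.val < 2) : p.eff i d ≤ p.a₁ := by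
  have := hp.lt₁₂; have := hp.lt₂₄; have := hp.mem₄.1
  simp only [Params.eff]
  split_ifs <;> linarith

theorem mem_paretoSet (hp : p.IsValid b) (hD : 1 < D) {i : Fin N} (hi : i.val < 2) :
    i ∈ paretoSet 0 (p.eff (N := N) (D := D)) := by
  rintro ⟨j, hj⟩
  have h := hj ⟨i.val, by omega⟩
  have h1 := hp.eff_le j (⟨i.val, by omega⟩ : Fin D) hi
  have h2 : p.eff i (⟨i.val, by omega⟩ : Fin D) = p.a₁ := by simp [Params.eff, hi]
  simp only [h2] at h
  linarith

theorem sub_le_eff_sub (hp : p.IsValid b) (hN : 0 < N) {i : Fin N} (hi : 2 ≤ i.val) (d : Fin D) :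
    p.a₂ - p.a₄ ≤ p.eff (⟨0, hN⟩ : Fin N) d - p.eff i d := by
  have := hp.lt₁₂; have := hp.lt₃₅
  simp only [Params.eff, if_neg (not_lt.2 hi), Nat.ofNat_pos, if_true]
  split_ifs <;> linarith

theorem notMem_paretoSet (hp : p.IsValid b) {ε : ℝ} (hε : ε < p.a₂ - p.a₄) {i : Fin N}
    (hi : 2 ≤ i.val) : i ∉ paretoSet ε (p.eff (N := N) (D := D)) := fun h =>
  h ⟨⟨0, by omega⟩, fun d => by
    have := hp.sub_le_eff_sub (by omega : 0 < N) hi d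
    linarith⟩

theorem sub_pos₂₄ (hp : p.IsValid b) : 0 < p.a₂ - p.a₄ := by
  linarith [hp.lt₂₄, hp.mem₄.1]

theorem mem_paretoSet_iff (hp : p.IsValid b) (hD : 1 < D) (i : Fin N) :
    i ∈ paretoSet 0 (p.eff (N := N) (D := D)) ↔ i.val < 2 := by
  refine ⟨fun h => ?_, hp.mem_paretoSet hD⟩
  by_contra! hi
  exact hp.notMem_paretoSet hp.sub_pos₂₄ hi h

theorem le_subOptGap (hp : p.IsValid b) (hD : 1 < D) {i : Fin N} (hi : 2 ≤ i.val) :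
    ENNReal.ofReal (p.a₂ - p.a₄) ≤ subOptGap (p.eff (N := N) (D := D)) i := by
  have hN : 0 < N := by omega
  have : Nonempty (Fin D) := ⟨⟨0, by omega⟩⟩
  refine le_trans ?_ (le_iSup₂ (f := fun j (_ : j ∈ paretoSet 0 (p.eff (N := N) (D := D))) =>
    ENNReal.ofReal (mGap (p.eff i) (p.eff j))) (⟨0, hN⟩ : Fin N)
    (hp.mem_paretoSet hD (by simp)))
  exact ENNReal.ofReal_le_ofReal
    (le_max_of_le_left (le_ciInf fun d => hp.sub_le_eff_sub hN hi d))

/-- Seen in the component with the index of `i`: group `i` has `a₁` there, and every other group has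
`a₂` or `a₄ < a₂`. -/
theorem le_MGap (hp : p.IsValid b) (hD : 1 < D) {i j : Fin N} (hi : i.val < 2) (hij : i ≠ j) :
    p.a₁ - p.a₂ ≤ MGap (p.eff (D := D) i) (p.eff j) := by
  have := hp.lt₁₂; have := hp.lt₂₄; have := hp.mem₄.1
  have hne : i.val ≠ j.val := fun h => hij (Fin.ext h)
  refine le_max_of_le_left (le_trans ?_ (le_ciSup (Set.finite_range _).bddAbove
    (⟨i.val, by omega⟩ : Fin D)))
  simp only [Params.eff, hi, if_true, if_neg hne]
  split_ifs <;> linarith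

end Params.IsValid

theorem subOptGap_ne_top (R : Fin N → Fin D → ℝ) (i : Fin N) : subOptGap R i ≠ ⊤ := by
  refine ne_top_of_le_ne_top (ENNReal.sum_ne_top.2 fun j (_ : j ∈ Finset.univ) =>
    ENNReal.ofReal_ne_top (r := mGap (R i) (R j))) (iSup₂_le fun j _ => ?_)
  exact Finset.single_le_sum (f := fun j => ENNReal.ofReal (mGap (R i) (R j)))
    (fun _ _ => zero_le) (Finset.mem_univ j)

/-- A lower bound for the gaps of the arms of group `i`. -/
def Params.gap (p : Params) (i : Fin N) : ℝ := if i.val < 2 then p.a₁ - p.a₂ else p.a₂ - p.a₄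

theorem Params.IsValid.gap_pos {b : ℝ} {p : Params} (hp : p.IsValid b) (i : Fin N) :
    0 < p.gap i := by
  unfold Params.gap
  split_ifs
  · exact sub_pos.2 hp.lt₁₂
  · exact hp.sub_pos₂₄

/-- For an optimal group, `optGapPlus` is controlled by `le_MGap` in both orders. In `optGapMinus`
the term `2 * Δ_j ≥ 2 * (a₂ - a₄)` already suffices, by `gap_lt`. -/
theorem Params.IsValid.gap_le_groupGap {b : ℝ} {p : Params} (hp : p.IsValid b) (hN : 1 < N)
    (hD : 1 < D) (i : Fin N) : p.gap i ≤ (groupGap (p.eff (N := N) (D := D)) i).toReal := by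
  by_cases hi : i.val < 2
  · have hmem := hp.mem_paretoSet hD hi
    rw [groupGap, if_pos hmem, Params.gap, if_pos hi, ← ENNReal.ofReal_le_iff_le_toReal]
    · refine le_min (le_iInf₂ fun j hj => le_min ?_ ?_) (le_iInf₂ fun j hj => ?_)
      · exact ENNReal.ofReal_le_ofReal (hp.le_MGap hD hi fun h => hj.2 h.symm)
      · exact ENNReal.ofReal_le_ofReal
          (hp.le_MGap hD ((hp.mem_paretoSet_iff hD j).1 hj.1) hj.2)
      · have hj' : 2 ≤ j.val := by
          by_contra! h
          exact hj (hp.mem_paretoSet hD h)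
        refine le_add_left ?_
        calc ENNReal.ofReal (p.a₁ - p.a₂) ≤ ENNReal.ofReal (2 * (p.a₂ - p.a₄)) :=
              ENNReal.ofReal_le_ofReal hp.gap_lt.le
          _ = 2 * ENNReal.ofReal (p.a₂ - p.a₄) := by
              rw [ENNReal.ofReal_mul (by norm_num)]; simp
          _ ≤ _ := by gcongr; exact hp.le_subOptGap hD hj'
    -- Finiteness matters because `toReal` sends `∞` to `0`. The other optimal group is a witness
    -- for it.
    · set k : Fin N := ⟨1 - i.val, by omega⟩
      have hk : k ∈ paretoSet 0 (p.eff (N := N) (D := D)) \ {i} :=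
        ⟨hp.mem_paretoSet hD (by simp only [k]; omega), fun h => by
          have := congrArg Fin.val (Set.mem_singleton_iff.1 h)
          simp only [k] at this
          omega⟩
      exact ne_top_of_le_ne_top ENNReal.ofReal_ne_top
        ((min_le_left _ _).trans ((iInf₂_le k hk).trans (min_le_left _ _)))
  · have hmem := (hp.mem_paretoSet_iff hD i).not.2 hi
    rw [groupGap, if_neg hmem, Params.gap, if_neg hi,
      ← ENNReal.ofReal_le_iff_le_toReal (subOptGap_ne_top _ _)]
    exact hp.le_subOptGap hD (not_lt.1 hi)

namespace IsHardInstance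

variable {b : ℝ} {p : Params} {ν : Env N K D}

theorem efficiency_eq_eff (h : IsHardInstance p ν) : efficiency ν = p.eff :=
  funext₂ h.efficiency_eq

theorem gap_le_totalGap (h : IsHardInstance p ν) (hp : p.IsValid b) (hN : 1 < N) (hD : 1 < D)
    (ε : ℝ) (i : Fin N) (j : Fin K) : p.gap i ≤ totalGap ε ν i j := by
  rw [totalGap, h.efficiency_eq_eff]
  exact le_max_of_le_right (le_max_of_le_left (hp.gap_le_groupGap hN hD i))

end IsHardInstance

theorem armMean_le_efficiency (ν : Env N K D) (i : Fin N) (j : Fin K) (d : Fin D) :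
    armMean ν i j d ≤ efficiency ν i d :=
  le_ciSup (f := fun j => armMean ν i j d) (Set.finite_range _).bddAbove j

namespace IsFullyDependentGaussian

variable {ν : Env N K D}

theorem efficiency_shiftArm_of_ne (h : IsFullyDependentGaussian ν) {i i' : Fin N} (hi : i' ≠ i)
    (j : Fin K) (s : ℝ) (d : Fin D) :
    efficiency (shiftArm ν (i, j) s) i' d = efficiency ν i' d := by
  simp [efficiency, h.armMean_shiftArm, hi]

theorem add_le_efficiency_shiftArm (h : IsFullyDependentGaussian ν) (i : Fin N) (j : Fin K) (s : ℝ)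
    (d : Fin D) : armMean ν i j d + s ≤ efficiency (shiftArm ν (i, j) s) i d := by
  have := armMean_le_efficiency (shiftArm ν (i, j) s) i j d
  rwa [h.armMean_shiftArm, if_pos rfl] at this

theorem isAdmissible_shiftArm (h : IsFullyDependentGaussian ν) {b : ℝ} {i : Fin N} {j : Fin K}
    {s : ℝ} (h0 : 0 ≤ s) (hm : ∀ i j d, armMean ν i j d ∈ Set.Icc 0 b)
    (hs : ∀ d, efficiency ν i d + s ≤ b) : IsAdmissible b (shiftArm ν (i, j) s) := by
  refine isAdmissible_of_gaussian (h.map_shiftArm (i, j) s) fun i' j' d => ?_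
  have := hm i' j' d
  split_ifs with hij
  · obtain ⟨rfl, rfl⟩ := Prod.mk.inj hij
    exact ⟨add_nonneg this.1 h0,
      (add_le_add_left (armMean_le_efficiency ν i' j' d) s).trans (hs d)⟩
  · simpa using this

end IsFullyDependentGaussian

/-! ### The lower bound -/

namespace Algorithm

/-- It suffices that `P` separates the answers accepted in `ν` from those accepted after the
translation: the PAC property in both environments then supplies the two error bounds. -/
theorem IsPAC.le_lintegral_stoppedCount {A : Algorithm N K D} {b ε δ : ℝ} (hA : A.IsPAC b ε δ)
    {ν : Env N K D} (hν : IsFullyDependentGaussian ν) (hadm : IsAdmissible b ν) (hD : 0 < D)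
    (hδ : 0 < δ) (hδ' : 2.4 * δ ≤ 1) (hτ : ∀ᵐ ω ∂(A.law ν), A.stopTime ω < ⊤)
    {i : Fin N} {j : Fin K} {s : ℝ} (hs : 0 < s) (hadm' : IsAdmissible b (shiftArm ν (i, j) s))
    {P : Set (Fin N) → Prop} (hP : ∀ t, MeasurableSet {h | P (A.recommend t h)})
    (h1 : ∀ S, paretoSet 0 (efficiency ν) ⊆ S → S ⊆ paretoSet ε (efficiency ν) → P S)
    (h2 : ∀ S, paretoSet 0 (efficiency (shiftArm ν (i, j) s)) ⊆ S →
      S ⊆ paretoSet ε (efficiency (shiftArm ν (i, j) s)) → ¬ P S) :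
    ENNReal.ofReal (Real.log (1 / (2.4 * δ)) / (2352 * s ^ 2))
      ≤ ∫⁻ ω, (A.stoppedCount (i, j) ω : ℝ≥0∞) ∂(A.law ν) := by
  refine A.le_lintegral_stoppedCount hν hD i j hs hδ hδ' hP hτ
    ((measure_mono fun ω hω => ?_).trans (hA ν hadm))
    ((measure_mono fun ω hω => ?_).trans (hA _ hadm'))
  · exact ⟨hω.1, fun hc => hω.2 (h1 _ hc.1 hc.2)⟩
  · exact ⟨hω.1, fun hc => h2 _ hc.1 hc.2 hω.2⟩

end Algorithm

namespace IsHardInstance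

variable {b : ℝ} {p : Params} {ν : Env N K D}

theorem mean_mem_Icc (h : IsHardInstance p ν) (hb : 1 ≤ b) (i : Fin N) (j : Fin K) (d : Fin D) :
    armMean ν i j d ∈ Set.Icc 0 b :=
  ⟨(h.mean_mem i j d).1.le, (h.mean_mem i j d).2.le.trans hb⟩

theorem isAdmissible (h : IsHardInstance p ν) (hb : 1 ≤ b) : IsAdmissible b ν :=
  isAdmissible_of_gaussian h.dist.gaussian (h.mean_mem_Icc hb)

/-- The lower bounds on the arms are made for this translation. In the first two components the
translated mean exceeds `(2 * a₂ - a₁) + 2 * (a₁ - a₂) + ε = a₁ + ε`. In the others it is at least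
`a₃ + (a₁ - a₂) + ε`. The other optimal group has at most `a₁`, respectively `a₃`. -/
theorem exists_alternative_opt (h : IsHardInstance p ν) (hp : p.IsValid b) (hN : 1 < N)
    (hD : 1 < D) {ε : ℝ} (hε : 0 < ε) (hε' : ε < p.smallEps b) {i : Fin N} (hi : i.val < 2)
    (j : Fin K) : ∃ k : Fin N, k ∈ paretoSet 0 (efficiency ν) ∧
      k ∉ paretoSet ε (efficiency (shiftArm ν (i, j) (2 * (p.a₁ - p.a₂) + ε))) := by
  have h12 : ε < p.a₁ - p.a₂ := lt_of_lt_of_le hε' ((min_le_left _ _).trans (min_le_left _ _))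
  set k : Fin N := ⟨1 - i.val, by omega⟩
  have hk2 : k.val < 2 := by simp only [k]; omega
  have hki : k ≠ i := fun hc => by
    have := congrArg Fin.val hc
    simp only [k] at this
    omega
  refine ⟨k, by rw [h.efficiency_eq_eff]; exact hp.mem_paretoSet hD hk2,
    fun hc => hc ⟨i, fun d => ?_⟩⟩
  refine lt_of_lt_of_le ?_ (h.dist.add_le_efficiency_shiftArm i j _ d)
  simp only [h.dist.efficiency_shiftArm_of_ne hki, h.efficiency_eq]
  have := hp.lt₁₂
  by_cases hd : d.val < 2
  · have h1 := h.lower_first i j d hi hd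
    have h2 := hp.eff_le k d hd
    linarith
  · have h1 := h.lower_rest i j d hi (not_lt.1 hd)
    have h2 : p.eff k d = p.a₃ := by simp only [Params.eff, if_pos hk2, if_neg hd]
    linarith

/-- Means are positive, so the translated arm exceeds `a₂` in every component, whereas each other
group has a component equal to `a₂` or `a₄ < a₂`. This is why the arms of these groups need no lower
bound in the class. -/
theorem mem_paretoSet_shiftArm (h : IsHardInstance p ν) (hp : p.IsValid b) (hD : 1 < D)
    {i : Fin N} (hi : 2 ≤ i.val) (j : Fin K) :
    i ∈ paretoSet 0 (efficiency (shiftArm ν (i, j) p.a₂)) := by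
  rintro ⟨k, hk⟩
  have hne : k ≠ i := by
    rintro rfl
    have := hk ⟨0, by omega⟩
    linarith
  have hlt : ∀ d, p.a₂ < p.eff k d := fun d => by
    have h1 := hk d
    have h2 := h.dist.add_le_efficiency_shiftArm i j p.a₂ d
    have h3 := (h.mean_mem i j d).1
    simp only [h.dist.efficiency_shiftArm_of_ne hne, h.efficiency_eq] at h1
    linarith
  have := hp.lt₂₄; have := hp.mem₄.1
  by_cases hk2 : k.val < 2
  · have h1 := hlt ⟨1 - k.val, by omega⟩
    have h3 : 1 - k.val ≠ k.val := by omega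
    have h4 : 1 - k.val < 2 := by omega
    simp only [Params.eff, if_pos hk2, if_pos h4, if_neg h3] at h1
    linarith
  · have h1 := hlt ⟨0, by omega⟩
    simp only [Params.eff, if_neg hk2, Nat.ofNat_pos, if_true] at h1
    linarith

theorem le_lintegral_stoppedCount (h : IsHardInstance p ν) (hp : p.IsValid b) (hb : 1 ≤ b)
    (hN : 1 < N) (hD : 1 < D) {ε : ℝ} (hε : 0 < ε) (hε' : ε < p.smallEps b) {δ : ℝ} (hδ : 0 < δ)
    (hδ' : 2.4 * δ ≤ 1) {A : Algorithm N K D} (hA : A.IsPAC b ε δ)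
    (hτ : ∀ᵐ ω ∂(A.law ν), A.stopTime ω < ⊤) (i : Fin N) (j : Fin K) :
    ENNReal.ofReal (Real.log (1 / (2.4 * δ)) / (21168 * p.gap i ^ 2))
      ≤ ∫⁻ ω, (A.stoppedCount (i, j) ω : ℝ≥0∞) ∂(A.law ν) := by
  have h12 : ε < p.a₁ - p.a₂ := lt_of_lt_of_le hε' ((min_le_left _ _).trans (min_le_left _ _))
  have h24 : ε < p.a₂ - p.a₄ := lt_of_lt_of_le hε' ((min_le_left _ _).trans (min_le_right _ _))
  have hroom : ε < b - (max p.a₁ p.a₃ + 2 * (p.a₁ - p.a₂)) := lt_of_lt_of_le hε' (min_le_right _ _)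
  have hy : 0 ≤ Real.log (1 / (2.4 * δ)) :=
    Real.log_nonneg (by rw [le_div_iff₀ (by positivity)]; linarith)
  have hg := hp.gap_pos i
  -- The factor `3` covers both translations: `2 * (a₁ - a₂) + ε < 3 * (a₁ - a₂)`, and `a₂ < 2 * (a₂
  -- - a₄)` by `lt₂₄`. Hence `21168 = 9 * 2352`.
  have hscale : ∀ s : ℝ, 0 < s → s ≤ 3 * p.gap i →
      ENNReal.ofReal (Real.log (1 / (2.4 * δ)) / (21168 * p.gap i ^ 2))
        ≤ ENNReal.ofReal (Real.log (1 / (2.4 * δ)) / (2352 * s ^ 2)) := fun s hs hs' => by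
    refine ENNReal.ofReal_le_ofReal (div_le_div_of_nonneg_left hy (by positivity) ?_)
    nlinarith
  have := hp.lt₁₂
  by_cases hi : i.val < 2
  · obtain ⟨k, hk, hk'⟩ := h.exists_alternative_opt hp hN hD hε hε' hi j
    have hs : 0 < 2 * (p.a₁ - p.a₂) + ε := by linarith
    refine (hscale _ hs (by rw [Params.gap, if_pos hi]; linarith)).trans
      (hA.le_lintegral_stoppedCount h.dist (h.isAdmissible hb) (by omega) hδ hδ' hτ hs
        (h.dist.isAdmissible_shiftArm hs.le (h.mean_mem_Icc hb) fun d => ?_)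
        -- The other optimal group `k` must be recommended in `ν` and must not be after the
        -- translation.
        (P := fun S => k ∈ S) (fun t => A.measurableSet_recommend t k)
        (fun S hS _ => hS hk) fun S _ hS hkS => hk' (hS hkS))
    have : p.eff i d ≤ max p.a₁ p.a₃ := by
      simp only [Params.eff, if_pos hi]
      split_ifs
      · exact le_max_left _ _
      · exact le_max_of_le_left hp.lt₁₂.le
      · exact le_max_right _ _
    rw [h.efficiency_eq]
    linarith
  · have hi' := not_lt.1 hi
    have hs : 0 < p.a₂ := hp.mem₂.1
    have hk := h.mem_paretoSet_shiftArm hp hD hi' j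
    refine (hscale _ hs (by rw [Params.gap, if_neg hi]; linarith [hp.lt₂₄])).trans
      (hA.le_lintegral_stoppedCount h.dist (h.isAdmissible hb) (by omega) hδ hδ' hτ hs
        (h.dist.isAdmissible_shiftArm hs.le (h.mean_mem_Icc hb) fun d => ?_)
        -- Group `i` itself is forbidden in `ν`, where it is dominated by more than `ε`, and
        -- compulsory after the translation.
        (P := fun S => i ∉ S) (fun t => (A.measurableSet_recommend t i).compl)
        (fun S _ hS hiS => ?_) fun S hS _ hiS => hiS (hS hk))
    · have : p.eff i d ≤ max p.a₄ p.a₅ := by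
        simp only [Params.eff, if_neg hi]
        split_ifs
        · exact le_max_left _ _
        · exact le_max_right _ _
      rw [h.efficiency_eq]
      linarith [hp.room_sub]
    · have := hS hiS
      rw [h.efficiency_eq_eff] at this
      exact hp.notMem_paretoSet h24 hi' this

theorem le_expectedSamples (h : IsHardInstance p ν) (hp : p.IsValid b) (hb : 1 ≤ b)
    (hN : 1 < N) (hD : 1 < D) {ε : ℝ} (hε : 0 < ε) (hε' : ε < p.smallEps b) {δ : ℝ} (hδ : 0 < δ)
    {A : Algorithm N K D} (hA : A.IsPAC b ε δ) (hτ : ∀ᵐ ω ∂(A.law ν), A.stopTime ω < ⊤) :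
    ENNReal.ofReal (1 / 21168 * ∑ i : Fin N, ∑ j : Fin K,
        1 / (totalGap ε ν i j) ^ 2 * Real.log (1 / (2.4 * δ))) ≤ A.expectedSamples ν := by
  by_cases hδ' : 2.4 * δ ≤ 1
  · have hy : 0 ≤ Real.log (1 / (2.4 * δ)) :=
      Real.log_nonneg (by rw [le_div_iff₀ (by positivity)]; linarith)
    refine le_trans ?_ (A.sum_lintegral_stoppedCount_le ν)
    have hnn : ∀ i : Fin N, 0 ≤ Real.log (1 / (2.4 * δ)) / (21168 * p.gap i ^ 2) :=
      fun i => by positivity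
    calc ENNReal.ofReal (1 / 21168 * ∑ i : Fin N, ∑ j : Fin K,
          1 / (totalGap ε ν i j) ^ 2 * Real.log (1 / (2.4 * δ)))
        ≤ ENNReal.ofReal (∑ i : Fin N, ∑ _j : Fin K,
            Real.log (1 / (2.4 * δ)) / (21168 * p.gap i ^ 2)) := by
          refine ENNReal.ofReal_le_ofReal ?_
          simp only [Finset.mul_sum]
          refine Finset.sum_le_sum fun i _ => Finset.sum_le_sum fun j _ => ?_
          have hg := hp.gap_pos i
          have hle := h.gap_le_totalGap hp hN hD ε i j
          have : 1 / (totalGap ε ν i j) ^ 2 ≤ 1 / p.gap i ^ 2 :=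
            one_div_le_one_div_of_le (by positivity) (by gcongr)
          calc _ ≤ 1 / 21168 * (1 / p.gap i ^ 2 * Real.log (1 / (2.4 * δ))) := by gcongr
            _ = _ := by field_simp
      _ = ∑ i : Fin N, ∑ _j : Fin K,
            ENNReal.ofReal (Real.log (1 / (2.4 * δ)) / (21168 * p.gap i ^ 2)) := by
          rw [ENNReal.ofReal_sum_of_nonneg fun i _ => Finset.sum_nonneg fun _ _ => hnn i]
          exact Finset.sum_congr rfl fun i _ => ENNReal.ofReal_sum_of_nonneg fun _ _ => hnn i
      _ ≤ _ := Finset.sum_le_sum fun i _ => Finset.sum_le_sum fun j _ =>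
          h.le_lintegral_stoppedCount hp hb hN hD hε hε' hδ hδ' hA hτ i j
  -- For `δ > 1 / 2.4` the asserted bound is nonpositive, hence trivial.
  · have hlog : Real.log (1 / (2.4 * δ)) ≤ 0 := by
      refine Real.log_nonpos (by positivity) ?_
      rw [div_le_one (by positivity)]
      exact (not_le.1 hδ').le
    rw [ENNReal.ofReal_of_nonpos]
    · exact zero_le
    · refine mul_nonpos_of_nonneg_of_nonpos (by norm_num) (Finset.sum_nonpos fun i _ =>
        Finset.sum_nonpos fun j _ => mul_nonpos_of_nonneg_of_nonpos (by positivity) hlog)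

end IsHardInstance

/-! ### Non-triviality of the class -/

/-- The environment in which the reward of every arm of group `i` is the constant vector
`p.eff i` plus a standard Gaussian number in all components. -/
def Params.env (p : Params) (N K D : ℕ) : Env N K D := fun i _ =>
  ⟨(gaussianReal 0 1).map fun z d => z + p.eff i d,
    Measure.isProbabilityMeasure_map (by fun_prop)⟩

theorem Params.coe_env (p : Params) (i : Fin N) (j : Fin K) :
    (p.env N K D i j : Measure (Fin D → ℝ)) = (gaussianReal 0 1).map fun z d => z + p.eff i d :=
  rfl

theorem Params.map_env (p : Params) (i : Fin N) (j : Fin K) (d : Fin D) :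
    (p.env N K D i j : Measure (Fin D → ℝ)).map (fun x => x d) = gaussianReal (p.eff i d) 1 := by
  rw [coe_env, Measure.map_map (by fun_prop) (by fun_prop)]
  have := gaussianReal_map_add_const (μ := 0) (v := 1) (p.eff i d)
  rw [zero_add] at this
  exact this

theorem Params.armMean_env (p : Params) (i : Fin N) (j : Fin K) (d : Fin D) :
    armMean (p.env N K D) i j d = p.eff i d :=
  integral_coord_of_gaussian (p.map_env i j d)

theorem Params.IsValid.isHardInstance_env {b : ℝ} {p : Params} (hp : p.IsValid b) (hK : 0 < K) :
    IsHardInstance p (p.env N K D) where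
  dist :=
    { gaussian := fun i j d => by rw [p.map_env, p.armMean_env]
      dependent := fun i j d d' => by
        rw [p.coe_env]
        refine (ae_map_iff (by fun_prop) (measurableSet_eq_fun (by fun_prop) (by fun_prop))).2 ?_
        refine Filter.Eventually.of_forall fun z => ?_
        simp only [p.armMean_env]
        ring }
  mean_mem i j d := by
    rw [p.armMean_env]
    unfold Params.eff
    split_ifs
    exacts [hp.mem₁, hp.mem₂, hp.mem₃, hp.mem₄, hp.mem₅]
  efficiency_eq i d := by
    have : Nonempty (Fin K) := ⟨⟨0, hK⟩⟩
    simp [efficiency, p.armMean_env]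
  lower_first i j d hi hd := by
    have := hp.lt₁₂
    rw [p.armMean_env, Params.eff, if_pos hi, if_pos hd]
    split_ifs <;> linarith
  lower_rest i j d hi hd := by
    have := hp.lt₁₂
    rw [p.armMean_env, Params.eff, if_pos hi, if_neg (not_lt.2 hd)]
    linarith

theorem Params.isValid_of_mem_Ioo {b x : ℝ} (hb : 1 ≤ b) (hx : x ∈ Set.Ioo (0.4 : ℝ) 0.5) :
    (⟨x, 0.4, 0.5, 0.1, 0.1⟩ : Params).IsValid b := by
  obtain ⟨h1, h2⟩ := hx
  norm_num at h1 h2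
  constructor <;> try (norm_num; try constructor)
  all_goals try linarith
  rw [max_eq_right (by linarith)]
  linarith

theorem Params.IsValid.smallEps_pos {b : ℝ} {p : Params} (hp : p.IsValid b) :
    0 < p.smallEps b :=
  lt_min (lt_min (sub_pos.2 hp.lt₁₂) hp.sub_pos₂₄) (sub_pos.2 hp.room_opt)

theorem infinite_setOf_isHardInstance (hN : 0 < N) (hK : 0 < K) (hD : 0 < D) {b : ℝ} (hb : 1 ≤ b) :
    {ν : Env N K D | ∃ p : Params, p.IsValid b ∧ IsHardInstance p ν}.Infinite := by
  -- The number `a₁` is the first mean of the first group, so a whole interval of values of `a₁`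
  -- yields infinitely many environments.
  refine Set.Infinite.of_image (fun ν : Env N K D => armMean ν ⟨0, hN⟩ ⟨0, hK⟩ ⟨0, hD⟩)
    ((Set.Ioo_infinite (by norm_num : (0.4 : ℝ) < 0.5)).mono fun x hx => ?_)
  have hp := Params.isValid_of_mem_Ioo hb hx
  refine ⟨_, ⟨_, hp, hp.isHardInstance_env hK⟩, ?_⟩
  simp [Params.armMean_env, Params.eff]

end GroupBandit

end

open GroupBandit in
theorem theorem2 :
    ∃ c : ℝ, 0 < c ∧
      ∀ (N K D : ℕ), 1 < N → 0 < K → 1 < D → ∀ b : ℝ, 1 ≤ b →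
        -- the class is non-trivial
        (∃ p : Params, p.IsValid b) ∧
        (∀ p : Params, p.IsValid b →
          0 < p.smallEps b ∧ ∃ ν : Env N K D, IsHardInstance p ν ∧ IsAdmissible b ν) ∧
        {ν : Env N K D | ∃ p : Params, p.IsValid b ∧ IsHardInstance p ν}.Infinite ∧
        -- the lower bound on every instance of the class
        ∀ p : Params, p.IsValid b → ∀ ν : Env N K D, IsHardInstance p ν →
          ∀ ε : ℝ, 0 < ε → ε < p.smallEps b →
            ∀ δ : ℝ, 0 < δ → δ < 1 →
              ∀ A : Algorithm N K D, A.IsPAC b ε δ →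
                (∀ᵐ ω ∂(A.law ν), A.stopTime ω < ⊤) →
                ENNReal.ofReal
                    (c * ∑ i : Fin N, ∑ j : Fin K,
                      1 / (totalGap ε ν i j) ^ 2 * Real.log (1 / (2.4 * δ)))
                  ≤ A.expectedSamples ν := by
  refine ⟨1 / 21168, by norm_num, fun N K D hN hK hD b hb => ⟨?_, fun p hp => ⟨hp.smallEps_pos, ?_⟩,
    infinite_setOf_isHardInstance (by omega) hK (by omega) hb, ?_⟩⟩
  · exact ⟨_, Params.isValid_of_mem_Ioo (x := 0.45) hb (by norm_num)⟩
  · exact ⟨_, hp.isHardInstance_env hK, (hp.isHardInstance_env hK).isAdmissible hb⟩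
  · intro p hp ν h ε hε hε' δ hδ _ A hA hτ
    exact h.le_expectedSamples hp hb hN hD hε hε' hδ hA hτ
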